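/- Let $X$ be a connected non-bipartite graph, finite or infinite, simple and undirected. Let $\mathcal N(X)$ be its neighborhood complex, that is, the simplicial complex whose simplices are the nonempty finite sets $W\subseteq V(X)$ of vertices that have a common neighbor in $X$. If the first homology group $H_1(\mathcal N(X))$ (simplicial homology with integer coefficients) is torsion, meaning that every element of it has finite order, then the chromatic number satisfies $\chi(X)\ge 4$. -/

import Mathlib

namespace PreAbstractSimplicialComplex

variable {V : Type*}

/-- The group `C_n(K)` of oriented simplicial `n`-chains of `K` with integer coefficients: finitely
supported integer functions `c` on ordered `(n+1)`-tuples of vertices which are supported on the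
tuples that enumerate an `n`-simplex of `K` without repetition, and which are alternating,
`c (v ∘ σ) = sign σ * c v`. The oriented simplex `[v₀, …, vₙ]` is the chain with value `sign σ` at
`v ∘ σ` for every permutation `σ`, and `0` elsewhere. -/
def chains (K : PreAbstractSimplicialComplex V) (n : ℕ) : AddSubgroup ((Fin (n + 1) → V) →₀ ℤ) where
  carrier := {c |
    (∀ v, c v ≠ 0 → ∃ h : Function.Injective v, Finset.univ.map ⟨v, h⟩ ∈ K.faces) ∧
    ∀ (v : Fin (n + 1) → V) (σ : Equiv.Perm (Fin (n + 1))),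
      c (v ∘ σ) = (Equiv.Perm.sign σ : ℤ) * c v}
  zero_mem' := by simp
  add_mem' := by
    rintro a b ⟨ha, ha'⟩ ⟨hb, hb'⟩
    refine ⟨fun v hv => ?_, fun v σ => ?_⟩
    · by_cases h : a v = 0
      · exact hb v (by simpa [h] using hv)
      · exact ha v h
    · simp only [Finsupp.add_apply, ha', hb', mul_add]
  neg_mem' := by
    rintro a ⟨ha, ha'⟩
    refine ⟨fun v hv => ha v (by simpa using hv), fun v σ => ?_⟩
    simp only [Finsupp.neg_apply, ha', mul_neg]

/-- Deleting the first entry of every tuple, extended linearly. -/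
noncomputable def dropFirst (V : Type*) (n : ℕ) :
    ((Fin (n + 2) → V) →₀ ℤ) →+ ((Fin (n + 1) → V) →₀ ℤ) :=
  Finsupp.mapDomain.addMonoidHom Fin.tail

theorem dropFirst_apply (n : ℕ) (c : (Fin (n + 2) → V) →₀ ℤ) (w : Fin (n + 1) → V) :
    dropFirst V n c w = ∑ᶠ x : V, c (Fin.cons x w) := by
  classical
  induction c using Finsupp.induction_linear with
  | zero => simp
  | add f g hf hg =>
    have fin : ∀ f : (Fin (n + 2) → V) →₀ ℤ,
        (Function.support fun x : V => f (Fin.cons x w)).Finite := fun f =>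
      Set.Finite.preimage (f := fun x : V => (Fin.cons x w : Fin (n + 2) → V))
        (fun a _ b _ h => by simpa using congrFun h 0) f.hasFiniteSupport
    rw [map_add, Finsupp.add_apply, hf, hg]
    simp only [Finsupp.add_apply]
    rw [finsum_add_distrib (fin f) (fin g)]
  | single v a =>
    have h1 : dropFirst V n (Finsupp.single v a) = Finsupp.single (Fin.tail v) a :=
      Finsupp.mapDomain_single
    rw [h1, finsum_eq_single _ (v 0)]
    · simp only [Finsupp.single_apply]
      congr 1
      rw [eq_iff_iff]
      constructor
      · rintro rfl; simp
      · intro h; rw [h]; simp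
    · intro x hx
      rw [Finsupp.single_apply, if_neg]
      intro h
      exact hx (by rw [h]; simp)

theorem dropFirst_mem (K : PreAbstractSimplicialComplex V) {n : ℕ}
    {c : (Fin (n + 2) → V) →₀ ℤ} (hc : c ∈ K.chains (n + 1)) : dropFirst V n c ∈ K.chains n := by
  obtain ⟨h1, h2⟩ := hc
  refine ⟨fun w hw => ?_, fun w σ => ?_⟩
  · rw [dropFirst_apply] at hw
    obtain ⟨x, hx⟩ : ∃ x : V, c (Fin.cons x w) ≠ 0 := by
      by_contra! h
      exact hw (by simp [h])
    obtain ⟨hi, hf⟩ := h1 _ hx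
    have hw' : Function.Injective w := (Fin.cons_injective_iff.1 hi).2
    refine ⟨hw', (K.isRelLowerSet_faces hf).2 ?_ (by simp)⟩
    intro y hy
    simp only [Finset.mem_map, Finset.mem_univ, true_and] at hy ⊢
    obtain ⟨i, rfl⟩ := hy
    exact ⟨i.succ, by simp⟩
  · rw [dropFirst_apply, dropFirst_apply, mul_finsum]
    refine finsum_congr fun x => ?_
    have := h2 (Fin.cons x w) (Equiv.Perm.decomposeFin.symm (0, σ))
    rw [Equiv.Perm.decomposeFin.symm_sign] at this
    simp only [if_true, one_mul] at this
    rw [← this]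
    congr 1
    funext i
    refine Fin.cases ?_ (fun j => ?_) i <;> simp

/-- The simplicial boundary map `∂ : C_{n+1}(K) → C_n(K)`. In terms of alternating functions
`(∂c)(w₀, …, wₙ) = ∑ₓ c(x, w₀, …, wₙ)`; on oriented simplices this is
`∂[v₀, …, vₙ₊₁] = ∑ᵢ (-1)^i [v₀, …, v̂ᵢ, …, vₙ₊₁]`, because moving `vᵢ` to the front of the
tuple is a permutation of sign `(-1)^i`. -/
noncomputable def boundary (K : PreAbstractSimplicialComplex V) (n : ℕ) :
    K.chains (n + 1) →+ K.chains n :=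
  ((dropFirst V n).comp (K.chains (n + 1)).subtype).codRestrict (K.chains n)
    fun c => dropFirst_mem K c.2

theorem boundary_boundary (K : PreAbstractSimplicialComplex V) (n : ℕ) (c : K.chains (n + 2)) :
    K.boundary n (K.boundary (n + 1) c) = 0 := by
  obtain ⟨c, h1, h2⟩ := c
  apply Subtype.ext
  change Finsupp.mapDomain Fin.tail (Finsupp.mapDomain Fin.tail c) = 0
  rw [← Finsupp.mapDomain_comp]
  let τ : Equiv.Perm (Fin (n + 3)) := Equiv.swap 0 1
  have hc : Finsupp.mapDomain (fun v => v ∘ τ) c = -c := by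
    ext v
    have hv : v = (fun v : Fin (n + 3) → V => v ∘ τ) (v ∘ τ) := by
      funext i; simp [τ]
    conv_lhs => rw [hv]
    rw [Finsupp.mapDomain_apply, h2]
    · simp [τ]
    · intro a b hab
      funext i
      simpa [τ] using congrFun hab (τ i)
  have key : Finsupp.mapDomain (Fin.tail ∘ Fin.tail) c =
      Finsupp.mapDomain (Fin.tail ∘ Fin.tail) (-c) := by
    rw [← hc, ← Finsupp.mapDomain_comp]
    congr 1
  have hneg : Finsupp.mapDomain (Fin.tail ∘ Fin.tail) (-c) =
      -Finsupp.mapDomain (Fin.tail ∘ Fin.tail) c :=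
    map_neg (Finsupp.mapDomain.addMonoidHom (M := ℤ) (α := Fin (n + 3) → V)
      (β := Fin (n + 1) → V) (Fin.tail (α := fun _ => V) ∘ Fin.tail (α := fun _ => V))) c
  rw [hneg] at key
  ext w
  have := DFunLike.congr_fun key w
  simp only [Finsupp.neg_apply] at this
  simp only [Finsupp.zero_apply]
  lia

/-- The group `Z_n(K)` of simplicial `n`-cycles (every `0`-chain is a cycle). -/
noncomputable def cycles (K : PreAbstractSimplicialComplex V) : (n : ℕ) → AddSubgroup (K.chains n)
  | 0 => ⊤
  | n + 1 => (K.boundary n).ker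

/-- The group `B_n(K)` of simplicial `n`-boundaries. -/
noncomputable def boundaries (K : PreAbstractSimplicialComplex V) (n : ℕ) :
    AddSubgroup (K.chains n) :=
  (K.boundary n).range

theorem boundaries_le_cycles (K : PreAbstractSimplicialComplex V) (n : ℕ) :
    K.boundaries n ≤ K.cycles n := by
  rintro _ ⟨c, rfl⟩
  cases n with
  | zero => exact AddSubgroup.mem_top _
  | succ n => exact K.boundary_boundary n c

/-- The simplicial homology group `H_n(K) = Z_n(K) / B_n(K)` with integer coefficients. -/
abbrev homology (K : PreAbstractSimplicialComplex V) (n : ℕ) : Type _ :=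
  K.cycles n ⧸ (K.boundaries n).addSubgroupOf (K.cycles n)

end PreAbstractSimplicialComplex

/-- The neighborhood complex of a graph: its simplices are the nonempty finite sets of vertices
which have a common neighbor. -/
def SimpleGraph.neighborhoodComplex {V : Type*} (X : SimpleGraph V) :
    PreAbstractSimplicialComplex V where
  faces := {W | W.Nonempty ∧ ∃ u, ∀ w ∈ W, X.Adj u w}
  isRelLowerSet_faces := by
    rintro W ⟨hW, u, hu⟩
    exact ⟨hW, fun T hT hT' => ⟨hT', u, fun w hw => hu w (hT hw)⟩⟩

open PreAbstractSimplicialComplex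

/-! A 3-colouring `C` would make `signedDiff` of colours a 1-cocycle on the neighborhood complex:
the vertices of a simplex avoid the colour of their common neighbor, so they use at most two colours
(`signedDiff_cocycle`). Non-bipartiteness gives an odd closed walk `p`. Traversed twice it has even
length, and its every second vertex traces a 1-cycle `z` (`Walk.exists_chain_of_even`). The cocycle
takes on `z` the value `-2 * p.signedLength C`, which is nonzero because `p.signedLength C` has the
parity of `p.length`. Boundaries pair to zero (`pairing_dropFirst_eq_zero`), so no positive multiple
of `z` bounds and `H₁` is not torsion. -/

/-- The representative in `{-1, 0, 1}` of the difference `y - x` modulo `3`. -/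
def signedDiff (x y : Fin 3) : ℤ :=
  if y = x + 1 then 1 else if x = y + 1 then -1 else 0

theorem signedDiff_swap (x y : Fin 3) : signedDiff y x = -signedDiff x y := by
  revert x y; decide

theorem odd_signedDiff {x y : Fin 3} (h : x ≠ y) : Odd (signedDiff x y) := by
  revert x y; decide

/-- Two steps that return to the same colour cancel; two steps through all three colours both equal
some `e = ±1`, and `2 * e ≡ -e` modulo 3. This converts walk length into the cocycle's value on the
edge joining the ends. -/
theorem signedDiff_add_of_ne {x y z : Fin 3} (hxy : x ≠ y) (hyz : y ≠ z) :
    signedDiff x y + signedDiff y z = -(2 * signedDiff x z) := by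
  revert x y z; decide

/-- With `u` excluded only two colours remain, so two of `x`, `y`, `z` coincide and the other terms
cancel by antisymmetry. -/
theorem signedDiff_cocycle {u x y z : Fin 3} (hx : u ≠ x) (hy : u ≠ y) (hz : u ≠ z) :
    signedDiff y z + signedDiff z x + signedDiff x y = 0 := by
  revert u x y z; decide

section

variable {V : Type*}

namespace PreAbstractSimplicialComplex

/-- The oriented edge `[a, b]` as an alternating function; it is `0` if `a = b`. -/
noncomputable def orientedEdge (a b : V) : (Fin 2 → V) →₀ ℤ :=
  Finsupp.single ![a, b] 1 - Finsupp.single ![b, a] 1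

theorem orientedEdge_mem_chains {K : PreAbstractSimplicialComplex V} [DecidableEq V] {a b : V}
    (h : ({a, b} : Finset V) ∈ K.faces) : orientedEdge a b ∈ K.chains 1 := by
  classical
  rcases eq_or_ne a b with rfl | hab
  · simp [orientedEdge, zero_mem]
  refine ⟨fun v hv => ?_, fun v σ => ?_⟩
  · have hv' : v = ![a, b] ∨ v = ![b, a] := by
      by_contra! hne
      exact hv (by simp [orientedEdge, hne.1.symm, hne.2.symm])
    rcases hv' with rfl | rfl
    · refine ⟨by simpa [Function.Injective, Fin.forall_fin_two] using ⟨hab, hab.symm⟩, ?_⟩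
      convert h using 1
      ext x
      simp [Fin.exists_fin_two, eq_comm]
    · refine ⟨by simpa [Function.Injective, Fin.forall_fin_two] using ⟨hab.symm, hab⟩, ?_⟩
      convert h using 1
      ext x
      simp [Fin.exists_fin_two, eq_comm, or_comm]
  · have hσ : σ = 1 ∨ σ = Equiv.swap 0 1 := by
      revert σ; decide
    rcases hσ with rfl | rfl
    · simp [Equiv.Perm.coe_one]
    · have key (x y : V) : ![x, y] = v ∘ Equiv.swap 0 1 ↔ ![y, x] = v := by
        simp [funext_iff, Fin.forall_fin_two, and_comm]
      simp [orientedEdge, Finsupp.single_apply, key]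

theorem dropFirst_orientedEdge (a b : V) :
    dropFirst V 0 (orientedEdge a b) = Finsupp.single ![b] 1 - Finsupp.single ![a] 1 := by
  have h (x y : V) : dropFirst V 0 (Finsupp.single ![x, y] 1) = Finsupp.single ![y] 1 :=
    Finsupp.mapDomain_single
  rw [orientedEdge, map_sub, h, h]

/-- Integration of a function of two vertices over functions on ordered pairs. -/
noncomputable def pairing (g : V → V → ℤ) : ((Fin 2 → V) →₀ ℤ) →+ ℤ :=
  Finsupp.liftAddHom fun v => AddMonoidHom.mulRight (g (v 0) (v 1))

/-- The factor 2 arises because both orderings of the edge contribute; it matches the 2 in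
`signedDiff_add_of_ne`. -/
theorem pairing_orientedEdge {g : V → V → ℤ} (hg : ∀ a b, g b a = -g a b) (a b : V) :
    pairing g (orientedEdge a b) = 2 * g a b := by
  have h (x y : V) : pairing g (Finsupp.single ![x, y] 1) = g x y := by simp [pairing]
  rw [orientedEdge, map_sub, h, h, hg a b]
  ring

/-- A `1`-cocycle vanishes on boundaries. -/
theorem pairing_dropFirst_eq_zero {K : PreAbstractSimplicialComplex V} {g : V → V → ℤ}
    (hg : ∀ v : Fin 3 → V, (∃ h : Function.Injective v, Finset.univ.map ⟨v, h⟩ ∈ K.faces) →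
      g (v 1) (v 2) + g (v 2) (v 0) + g (v 0) (v 1) = 0)
    {c : (Fin 3 → V) →₀ ℤ} (hc : c ∈ K.chains 2) : pairing g (dropFirst V 1 c) = 0 := by
  let S (σ : Equiv.Perm (Fin 3)) : ℤ := c.sum fun v n => n * g (v (σ 1)) (v (σ 2))
  have hS : pairing g (dropFirst V 1 c) = S 1 := by
    change Finsupp.liftAddHom _ (Finsupp.mapDomain Fin.tail c) = _
    rw [Finsupp.liftAddHom_apply, Finsupp.sum_mapDomain_index (by simp) (by simp [add_mul])]
    rfl
  -- Even permutations of the entries preserve the alternating chain `c`, so all three rotations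
  -- give the same sum. Their total vanishes by the cocycle condition, hence `3 * S 1 = 0`.
  have hrot (σ : Equiv.Perm (Fin 3)) (hσ : Equiv.Perm.sign σ = 1) : S 1 = S σ := by
    have hmap : Finsupp.mapDomain (fun v => v ∘ σ) c = c := by
      ext v
      have hv : v = (fun v : Fin 3 → V => v ∘ σ) (v ∘ σ.symm) := by
        funext i; simp
      conv_lhs => rw [hv]
      rw [Finsupp.mapDomain_apply σ.surjective.injective_comp_right, hc.2]
      simp [hσ]
    change c.sum _ = c.sum _
    conv_lhs => rw [← hmap]
    rw [Finsupp.sum_mapDomain_index (by simp) (by simp [add_mul])]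
    rfl
  have hsum : S 1 + S (finRotate 3) + S (finRotate 3 * finRotate 3) = 0 := by
    simp only [S, ← Finsupp.sum_add]
    refine Finset.sum_eq_zero fun v hv => ?_
    have := hg v (hc.1 v (Finsupp.mem_support_iff.1 hv))
    change c v * g (v 1) (v 2) + c v * g (v 2) (v 0) + c v * g (v 0) (v 1) = 0
    rw [← mul_add, ← mul_add, this, mul_zero]
  have h1 := hrot (finRotate 3) (by decide)
  have h2 := hrot (finRotate 3 * finRotate 3) (by decide)
  lia

end PreAbstractSimplicialComplex

namespace SimpleGraph

variable {X : SimpleGraph V}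

/-- The total signed colour change along a walk in a graph with a `3`-colouring. -/
def Walk.signedLength (C : X.Coloring (Fin 3)) : {a b : V} → X.Walk a b → ℤ
  | _, _, .nil => 0
  | _, _, .cons (u := u) (v := v) _ p => signedDiff (C u) (C v) + p.signedLength C

theorem Walk.signedLength_append (C : X.Coloring (Fin 3)) {a b c : V} (p : X.Walk a b)
    (q : X.Walk b c) : (p.append q).signedLength C = p.signedLength C + q.signedLength C := by
  induction p with
  | nil => simp [signedLength]
  | cons h p ih => simp [signedLength, ih, add_assoc]

theorem Walk.even_signedLength_sub_length (C : X.Coloring (Fin 3)) {a b : V} (p : X.Walk a b) :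
    Even (p.signedLength C - p.length) := by
  induction p with
  | nil => simp [signedLength]
  | cons h p ih =>
    have := odd_signedDiff (C.valid h)
    simp only [signedLength, length_cons, Nat.cast_add, Nat.cast_one]
    grind

/-- Every second vertex of a walk of even length traces a path in the neighborhood complex. -/
theorem Walk.exists_chain_of_even (C : X.Coloring (Fin 3)) : {a b : V} → (p : X.Walk a b) →
    Even p.length → ∃ z ∈ X.neighborhoodComplex.chains 1,
      dropFirst V 0 z = Finsupp.single ![b] 1 - Finsupp.single ![a] 1 ∧
      pairing (fun u v => signedDiff (C u) (C v)) z = -p.signedLength C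
  | _, _, .nil, _ => ⟨0, zero_mem _, by simp, by simp [signedLength]⟩
  | _, _, .cons _ .nil, h => by simp at h
  | a, b, .cons (v := u) hu (.cons (v := w) hw p), h => by
    classical
    obtain ⟨z, hz, hd, hp⟩ := p.exists_chain_of_even C (by
      simp only [length_cons] at h; grind)
    -- If the walk backtracks, then `a = w` and the added edge is the zero chain.
    refine ⟨orientedEdge a w + z, add_mem (orientedEdge_mem_chains ?_) hz, ?_, ?_⟩
    · exact ⟨by simp, u, by simp [hu.symm, hw]⟩
    · rw [map_add, dropFirst_orientedEdge, hd]
      abel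
    · rw [map_add, pairing_orientedEdge (fun a b => signedDiff_swap (C a) (C b)), hp]
      have := signedDiff_add_of_ne (C.valid hu) (C.valid hw)
      simp only [signedLength]
      lia

/-- An odd closed walk in a `3`-colourable graph, traversed twice, yields a class of infinite order
in the first homology of the neighborhood complex. -/
theorem not_isAddTorsion_homology_one (C : X.Coloring (Fin 3)) {a : V} (p : X.Walk a a)
    (hp : Odd p.length) : ¬ IsAddTorsion (X.neighborhoodComplex.homology 1) := by
  intro htors
  obtain ⟨z, hz, hd, hpair⟩ := (p.append p).exists_chain_of_even C (by simp)
  have hcyc : (⟨z, hz⟩ : X.neighborhoodComplex.chains 1) ∈ X.neighborhoodComplex.cycles 1 :=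
    Subtype.ext (hd.trans (sub_self _))
  obtain ⟨m, hm, hmz⟩ := isOfFinAddOrder_iff_nsmul_eq_zero.1
    (htors (QuotientAddGroup.mk ⟨⟨z, hz⟩, hcyc⟩))
  rw [← QuotientAddGroup.mk_nsmul, QuotientAddGroup.eq_zero_iff, AddSubgroup.mem_addSubgroupOf]
    at hmz
  obtain ⟨c, hc⟩ := hmz
  have hcz : dropFirst V 1 c.1 = m • z := congrArg Subtype.val hc
  have h0 := pairing_dropFirst_eq_zero (g := fun u v => signedDiff (C u) (C v)) (fun v hv => by
    obtain ⟨_, _, u, hu⟩ := hv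
    have hu' (i : Fin 3) : X.Adj u (v i) := hu _ (by simp)
    exact signedDiff_cocycle (C.valid (hu' 0)) (C.valid (hu' 1)) (C.valid (hu' 2))) c.2
  rw [hcz, map_nsmul, hpair, smul_eq_zero, Walk.signedLength_append] at h0
  -- `h0` says that `m` or twice the signed length of `p` vanishes; but `m` is positive and this
  -- signed length is odd.
  have := p.even_signedLength_sub_length C
  obtain ⟨k, hk⟩ := hp
  obtain ⟨l, hl⟩ := this
  lia

end SimpleGraph

end

theorem theorem1p4 {V : Type*} (X : SimpleGraph V) (hconn : X.Connected)
    (hbip : ¬ X.IsBipartite) (htors : IsAddTorsion (X.neighborhoodComplex.homology 1)) :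
    4 ≤ X.chromaticNumber := by
  refine SimpleGraph.le_chromaticNumber_iff_colorable.2 fun m hm => ?_
  by_contra hlt
  have hm3 : m ≤ 3 := by
    have : m < 4 := by exact_mod_cast not_le.1 hlt
    lia
  obtain ⟨C⟩ := hm.mono hm3
  have hodd := mt SimpleGraph.two_colorable_iff_forall_loop_even.2 hbip
  push Not at hodd
  obtain ⟨u, w, hw⟩ := hodd
  exact SimpleGraph.not_isAddTorsion_homology_one C w (Nat.not_even_iff_odd.1 hw) htors
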